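/- Let $F$ be a field of characteristic different from $2$, and let $A$ be a Novikov algebra over $F$, that is, a (not necessarily associative or unital) $F$-algebra satisfying $(x,y,z)=(y,x,z)$ and $(xy)z=(xz)y$ for all $x,y,z\in A$, where $(x,y,z)=(xy)z-x(yz)$. Put $A^{(0)_L}=A$ and let $A^{(n+1)_L}$ be the linear span of all commutators $uv-vu$ with $u,v\in A^{(n)_L}$; assume that $A$ is Lie-solvable, i.e. $A^{(n)_L}=0$ for some $n\ge 0$. Call an algebra $B$ left-quasiregular if for every $x\in B$ there is $y\in B$ with $x+y=yx$. Let $\mathcal C$ be the class of all Novikov $F$-algebras whose heart $H$ (the intersection of all nonzero two-sided ideals) is nonzero and idempotent ($H^2=H$, where $H^2$ is the span of all products of two elements of $H$); let $\mathcal A$ be the class of all Novikov $F$-algebras that have no homomorphism onto an algebra in $\mathcal C$. The Andrunakievich radical $\mathcal A(A)$ is the largest two-sided ideal of $A$ that, as an algebra, belongs to $\mathcal A$. If $I$ is a two-sided ideal of $A$ such that the algebras $I$ and $A/I$ are left-quasiregular, then $A$ is left-quasiregular. Moreover, $A=\mathcal A(A)$. -/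

import Mathlib

universe u

/-- The identities of a Novikov algebra: the associator is symmetric in its first two arguments,
and right multiplications commute. -/
structure IsNovikov (A : Type*) [NonUnitalNonAssocRing A] : Prop where
  associator_symm : ∀ x y z : A, associator x y z = associator y x z
  right_comm : ∀ x y z : A, (x * y) * z = (x * z) * y

/-- An algebra is left-quasiregular if every `x` has a `y` in the algebra with `x + y = yx`. -/
def IsLeftQuasiregular (A : Type*) [NonUnitalNonAssocRing A] : Prop :=
  ∀ x : A, ∃ y : A, x + y = y * x

/-- Two-sided ideals of a (nonassociative, nonunital) algebra `A` over `F`. -/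
structure AlgIdeal (F A : Type*) [Field F] [NonUnitalNonAssocRing A] [Module F A] extends
    Submodule F A where
  mul_mem_left' : ∀ a x : A, x ∈ carrier → a * x ∈ carrier
  mul_mem_right' : ∀ x a : A, x ∈ carrier → x * a ∈ carrier

namespace AlgIdeal

section Basic

variable {F A : Type*} [Field F] [NonUnitalNonAssocRing A] [Module F A]

instance : SetLike (AlgIdeal F A) A where
  coe I := I.carrier
  coe_injective I J h := by
    cases I; cases J; congr 1; exact SetLike.coe_injective h

instance : PartialOrder (AlgIdeal F A) := PartialOrder.ofSetLike (AlgIdeal F A) A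

instance : NonUnitalSubringClass (AlgIdeal F A) A where
  add_mem {I} _ _ ha hb := I.toSubmodule.add_mem ha hb
  zero_mem I := I.toSubmodule.zero_mem
  neg_mem {I} _ ha := I.toSubmodule.neg_mem ha
  mul_mem {I} a b _ hb := I.mul_mem_left' a b hb

instance : SMulMemClass (AlgIdeal F A) F A where
  smul_mem {I} r _ hx := I.toSubmodule.smul_mem r hx

/-- The whole algebra, as an ideal. -/
instance : Top (AlgIdeal F A) where
  top := { (⊤ : Submodule F A) with
    mul_mem_left' := fun _ _ _ => trivial
    mul_mem_right' := fun _ _ _ => trivial }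

/-- The underlying space of the quotient algebra `A / I`. -/
def QuotAlg (I : AlgIdeal F A) : Type _ := A ⧸ I.toSubmodule

instance (I : AlgIdeal F A) : AddCommGroup I.QuotAlg :=
  inferInstanceAs (AddCommGroup (A ⧸ I.toSubmodule))

instance (I : AlgIdeal F A) : Module F I.QuotAlg :=
  inferInstanceAs (Module F (A ⧸ I.toSubmodule))

/-- The class of an element in the quotient algebra. -/
def proj (I : AlgIdeal F A) : A →ₗ[F] I.QuotAlg := I.toSubmodule.mkQ

theorem proj_surjective (I : AlgIdeal F A) : Function.Surjective I.proj :=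
  I.toSubmodule.mkQ_surjective

theorem proj_eq_proj (I : AlgIdeal F A) {a b : A} : I.proj a = I.proj b ↔ a - b ∈ I :=
  Submodule.Quotient.eq I.toSubmodule

/-- The product of the classes of `a` and `b` is the class of `a * b`. -/
instance (I : AlgIdeal F A) : Mul I.QuotAlg where
  mul := Quotient.map₂ (· * ·) (by
    intro a a' ha b b' hb
    have ha' : a - a' ∈ I := (Submodule.quotientRel_def _).1 ha
    have hb' : b - b' ∈ I := (Submodule.quotientRel_def _).1 hb
    refine (Submodule.quotientRel_def _).2 ?_
    have h : a * b - a' * b' = (a - a') * b + a' * (b - b') := by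
      rw [sub_mul, mul_sub]; abel
    change a * b - a' * b' ∈ I
    rw [h]
    exact add_mem (I.mul_mem_right' _ _ ha') (I.mul_mem_left' _ _ hb'))

theorem proj_mul (I : AlgIdeal F A) (a b : A) : I.proj (a * b) = I.proj a * I.proj b := rfl

/-- The quotient algebra `A / I`. -/
instance (I : AlgIdeal F A) : NonUnitalNonAssocRing I.QuotAlg where
  left_distrib x y z := by
    obtain ⟨a, rfl⟩ := I.proj_surjective x
    obtain ⟨b, rfl⟩ := I.proj_surjective y
    obtain ⟨c, rfl⟩ := I.proj_surjective z
    rw [← map_add, ← proj_mul, mul_add, map_add, proj_mul, proj_mul]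
  right_distrib x y z := by
    obtain ⟨a, rfl⟩ := I.proj_surjective x
    obtain ⟨b, rfl⟩ := I.proj_surjective y
    obtain ⟨c, rfl⟩ := I.proj_surjective z
    rw [← map_add, ← proj_mul, add_mul, map_add, proj_mul, proj_mul]
  zero_mul x := by
    obtain ⟨a, rfl⟩ := I.proj_surjective x
    rw [← map_zero I.proj, ← proj_mul, zero_mul]
  mul_zero x := by
    obtain ⟨a, rfl⟩ := I.proj_surjective x
    rw [← map_zero I.proj, ← proj_mul, mul_zero]

instance [IsScalarTower F A A] (I : AlgIdeal F A) : IsScalarTower F I.QuotAlg I.QuotAlg where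
  smul_assoc r x y := by
    obtain ⟨a, rfl⟩ := I.proj_surjective x
    obtain ⟨b, rfl⟩ := I.proj_surjective y
    rw [smul_eq_mul, smul_eq_mul, ← map_smul, ← proj_mul, ← proj_mul, smul_mul_assoc, map_smul]

instance [SMulCommClass F A A] (I : AlgIdeal F A) : SMulCommClass F I.QuotAlg I.QuotAlg where
  smul_comm r x y := by
    obtain ⟨a, rfl⟩ := I.proj_surjective x
    obtain ⟨b, rfl⟩ := I.proj_surjective y
    rw [smul_eq_mul, smul_eq_mul, ← map_smul, ← proj_mul, ← proj_mul, mul_smul_comm, map_smul]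

end Basic

end AlgIdeal

section Notions

variable (F A : Type*) [Field F] [NonUnitalNonAssocRing A] [Module F A]

/-- The Lie-solvable powers: the zeroth is `A`, and the `(n+1)`-st is the subspace spanned by the
commutators of elements of the `n`-th. -/
def lieSolvablePower : ℕ → Submodule F A
  | 0 => ⊤
  | n + 1 => Submodule.span F
      {z | ∃ x ∈ lieSolvablePower n, ∃ y ∈ lieSolvablePower n, z = x * y - y * x}

/-- `A` is Lie-solvable if some Lie-solvable power of it vanishes. -/
def IsLieSolvable : Prop := ∃ n : ℕ, lieSolvablePower F A n = ⊥

/-- The heart: the intersection of all nonzero ideals. -/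
def heart : Submodule F A :=
  sInf {M | ∃ I : AlgIdeal F A, I.toSubmodule = M ∧ M ≠ ⊥}

/-- `A` is subdirectly irreducible: the intersection of all its nonzero ideals is nonzero. (The
zero algebra has no nonzero ideals; its heart is the zero space, so it is excluded.) -/
def IsSubdirectlyIrreducible : Prop := heart F A ≠ ⊥

/-- The heart `H` is idempotent: `H` is spanned by the products of its elements. -/
def HasIdempotentHeart : Prop :=
  Submodule.span F {z | ∃ x ∈ heart F A, ∃ y ∈ heart F A, z = x * y} = heart F A

/-- `A` is a subdirectly irreducible Novikov algebra with idempotent heart. -/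
def IsNovikovSIWithIdempotentHeart : Prop :=
  IsNovikov A ∧ IsSubdirectlyIrreducible F A ∧ HasIdempotentHeart F A

end Notions

/-- The Andrunakievich radical class: Novikov algebras with no homomorphism onto a subdirectly
irreducible Novikov algebra with idempotent heart. (A homomorphic image of `A` has an isomorphic
copy in the universe of `A`.) -/
def IsAndrunakievich (F : Type*) (A : Type u) [Field F] [NonUnitalNonAssocRing A] [Module F A] :
    Prop :=
  IsNovikov A ∧
    ∀ (B : Type u) [NonUnitalNonAssocRing B] [Module F B] [IsScalarTower F B B]
      [SMulCommClass F B B] (f : A →ₙₐ[F] B),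
      Function.Surjective f → ¬ IsNovikovSIWithIdempotentHeart F B

/-- `R` is the Andrunakievich radical of `A`: the largest ideal of `A` that, as an algebra, belongs
to the Andrunakievich radical class. -/
def IsAndrunakievichRadical {F A : Type*} [Field F] [NonUnitalNonAssocRing A] [Module F A]
    (R : AlgIdeal F A) : Prop :=
  IsGreatest {J : AlgIdeal F A | IsAndrunakievich F J} R

/-!
Let `T` be the commutative algebra generated by the right multiplications `R_a` of a Novikov
algebra `A`. Commutation with the left multiplication `L_a` is a derivation `δ_a` of `T`, with
`δ_a R_b = R_{ab} - R_a R_b` and `δ_{ab} = R_b δ_a`. When `k` lies in a term of the Lie-solvable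
series whose next term acts on the right by nilpotents, these relations give `2 (δ_k R_a)² = 0`
modulo the nilradical of `T`. Descending induction along the series then shows that `a ↦ R_a` is
multiplicative modulo the nilradical, so that `(1 - R_y) (1 - R_x)` and `1 - R_{x + y - yx}` are
units together. This transports left-quasiregularity from `I` and `A / I` to `A`.

For the radical, a homomorphic image `B` with nonzero heart has its heart inside the last nonzero
term of the Lie-solvable series, a commutative ideal. An idempotent heart is then a commutative
minimal ideal with nonzero multiplication, so it contains some `e` and `x ≠ 0` with `xe = x`, and
`e` has no left quasi-inverse.
-/

section NovikovIdentities

variable {A : Type*} [NonUnitalNonAssocRing A]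

namespace IsNovikov

theorem lie_mul (hA : IsNovikov A) (a b c : A) : ⁅a, b⁆ * c = a * (b * c) - b * (a * c) := by
  have h := hA.associator_symm a b c
  simp only [associator_apply] at h
  rw [Ring.lie_def, sub_mul]
  linear_combination (norm := abel) h

theorem two_nsmul_lie_mul (hA : IsNovikov A) (a b c : A) :
    2 • (⁅a, b⁆ * c) = ⁅a * c, b⁆ - ⁅b * c, a⁆ := by
  have h := hA.lie_mul a b c
  simp only [Ring.lie_def, sub_mul, two_nsmul, hA.right_comm a c b, hA.right_comm b c a] at h ⊢
  linear_combination (norm := abel) h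

theorem lie_leibniz (hA : IsNovikov A) (a b c : A) : ⁅c, ⁅a, b⁆⁆ = ⁅⁅c, a⁆, b⁆ + ⁅a, ⁅c, b⁆⁆ :=
  letI : LeftPreLieRing A := { ‹NonUnitalNonAssocRing A› with assoc_symm' := hA.associator_symm }
  leibniz_lie c a b

theorem associator_mul_left (hA : IsNovikov A) (a b x c : A) :
    associator (a * b) x c = associator a x c * b := by
  simp only [associator_apply, sub_mul, hA.right_comm a b, hA.right_comm (a * x) b]

theorem of_surjective {F B : Type*} [NonUnitalNonAssocRing B] [FunLike F A B]
    [NonUnitalRingHomClass F A B] (hA : IsNovikov A) {f : F} (hf : Function.Surjective f) :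
    IsNovikov B where
  associator_symm := hf.forall₃.2 fun x y z => by
    simpa only [associator_apply, map_sub, map_mul] using congrArg f (hA.associator_symm x y z)
  right_comm := hf.forall₃.2 fun x y z => by
    simpa only [map_mul] using congrArg f (hA.right_comm x y z)

end IsNovikov

end NovikovIdentities

section LieSolvablePower

variable {F A : Type*} [Field F] [NonUnitalNonAssocRing A] [Module F A]

theorem lie_mem_lieSolvablePower_succ {n : ℕ} {x y : A}
    (hx : x ∈ lieSolvablePower F A n) (hy : y ∈ lieSolvablePower F A n) :
    ⁅x, y⁆ ∈ lieSolvablePower F A (n + 1) :=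
  Submodule.subset_span ⟨x, hx, y, hy, rfl⟩

theorem lieSolvablePower_succ_le {n : ℕ} {M : Submodule F A} :
    lieSolvablePower F A (n + 1) ≤ M ↔
      ∀ x ∈ lieSolvablePower F A n, ∀ y ∈ lieSolvablePower F A n, ⁅x, y⁆ ∈ M := by
  refine Submodule.span_le.trans ⟨fun h x hx y hy => h ⟨x, hx, y, hy, rfl⟩, ?_⟩
  rintro h _ ⟨x, hx, y, hy, rfl⟩
  exact h x hx y hy

theorem lieSolvablePower_antitone : Antitone (lieSolvablePower F A) := by
  refine antitone_nat_of_succ_le fun n => ?_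
  induction n with
  | zero => exact le_top
  | succ n ih =>
    exact lieSolvablePower_succ_le.2 fun x hx y hy => lie_mem_lieSolvablePower_succ (ih hx) (ih hy)

theorem IsLieSolvable.exists_succ_eq_bot [Nontrivial A] (hLie : IsLieSolvable F A) :
    ∃ n, lieSolvablePower F A n ≠ ⊥ ∧ lieSolvablePower F A (n + 1) = ⊥ := by
  by_contra! h
  obtain ⟨n, hn⟩ := hLie
  induction n with
  | zero => exact top_ne_bot hn
  | succ n ih => exact ih (by_contra fun hne => h n hne hn)

theorem IsLieSolvable.of_surjective {B : Type*} [NonUnitalNonAssocRing B] [Module F B]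
    (hLie : IsLieSolvable F A) {f : A →ₙₐ[F] B} (hf : Function.Surjective f) :
    IsLieSolvable F B := by
  have hle (n : ℕ) :
      lieSolvablePower F B n ≤ (lieSolvablePower F A n).map (f : A →ₗ[F] B) := by
    induction n with
    | zero => exact fun y _ => (hf y).imp fun x hx => ⟨trivial, hx⟩
    | succ n ih =>
      refine lieSolvablePower_succ_le.2 fun x hx y hy => ?_
      obtain ⟨a, ha, rfl⟩ := ih hx
      obtain ⟨b, hb, rfl⟩ := ih hy
      exact ⟨⁅a, b⁆, lie_mem_lieSolvablePower_succ ha hb, by simp [Ring.lie_def]⟩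
  obtain ⟨n, hn⟩ := hLie
  exact ⟨n, le_bot_iff.1 ((hle n).trans (by rw [hn, Submodule.map_bot]))⟩

variable [IsScalarTower F A A]

theorem IsNovikov.lieSolvablePower_mul_mem (hA : IsNovikov A) (h2 : (2 : F) ≠ 0) {n : ℕ} {x : A}
    (hx : x ∈ lieSolvablePower F A n) (c : A) : x * c ∈ lieSolvablePower F A n := by
  induction n generalizing x c with
  | zero => trivial
  | succ n ih =>
    suffices h : lieSolvablePower F A (n + 1) ≤
        (lieSolvablePower F A (n + 1)).comap (LinearMap.mulRight F c) from h hx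
    refine lieSolvablePower_succ_le.2 fun a ha b hb => ?_
    rw [Submodule.mem_comap, LinearMap.mulRight_apply, ← Submodule.smul_mem_iff _ h2,
      ofNat_smul_eq_nsmul, hA.two_nsmul_lie_mul]
    exact sub_mem (lie_mem_lieSolvablePower_succ (ih ha c) hb)
      (lie_mem_lieSolvablePower_succ (ih hb c) ha)

variable [SMulCommClass F A A]

theorem IsNovikov.mul_lieSolvablePower_mem (hA : IsNovikov A) (h2 : (2 : F) ≠ 0) {n : ℕ} {x : A}
    (hx : x ∈ lieSolvablePower F A n) (c : A) : c * x ∈ lieSolvablePower F A n := by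
  induction n generalizing x c with
  | zero => trivial
  | succ n ih =>
    suffices h : lieSolvablePower F A (n + 1) ≤
        (lieSolvablePower F A (n + 1)).comap (LinearMap.mulLeft F c) from h hx
    refine lieSolvablePower_succ_le.2 fun a ha b hb => ?_
    have hlie {z : A} (hz : z ∈ lieSolvablePower F A n) : ⁅c, z⁆ ∈ lieSolvablePower F A n :=
      sub_mem (ih hz c) (hA.lieSolvablePower_mul_mem h2 hz c)
    have hmul : c * ⁅a, b⁆ = ⁅a, b⁆ * c + (⁅⁅c, a⁆, b⁆ + ⁅a, ⁅c, b⁆⁆) := by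
      rw [← hA.lie_leibniz, Ring.lie_def c, add_sub_cancel]
    rw [Submodule.mem_comap, LinearMap.mulLeft_apply, hmul]
    exact add_mem (hA.lieSolvablePower_mul_mem h2 (lie_mem_lieSolvablePower_succ ha hb) c)
      (add_mem (lie_mem_lieSolvablePower_succ (hlie ha) hb)
        (lie_mem_lieSolvablePower_succ ha (hlie hb)))

theorem IsLieSolvable.exists_isMulCommutative_ideal [Nontrivial A] (hLie : IsLieSolvable F A)
    (hA : IsNovikov A) (h2 : (2 : F) ≠ 0) :
    ∃ K : AlgIdeal F A, K.toSubmodule ≠ ⊥ ∧ IsMulCommutative K := by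
  obtain ⟨n, hn, hn'⟩ := hLie.exists_succ_eq_bot
  refine ⟨⟨lieSolvablePower F A n, fun c _ hx => hA.mul_lieSolvablePower_mem h2 hx c,
    fun _ c hx => hA.lieSolvablePower_mul_mem h2 hx c⟩, hn,
    .of_setLike_mul_comm fun x hx y hy => sub_eq_zero.1 ?_⟩
  rw [← Submodule.mem_bot F, ← hn']
  exact lie_mem_lieSolvablePower_succ hx hy

end LieSolvablePower

section RightMultiplication

open scoped IsMulCommutative

variable (F A : Type*) [Field F] [NonUnitalNonAssocRing A] [Module F A] [IsScalarTower F A A]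
  [SMulCommClass F A A]

/-- The right multiplication algebra of `A`: the algebra of endomorphisms of `A` generated by the
maps `x ↦ x * a`. It is commutative when `A` is a Novikov algebra; that hypothesis is carried by
`Fact` so that the commutative ring structure is found by instance search. -/
def rightMulAlgebra : Subalgebra F (Module.End F A) :=
  Algebra.adjoin F (Set.range (LinearMap.mul F A).flip)

/-- Right multiplication `x ↦ x * a` by `a`, as an element of the right multiplication algebra. -/
def rightMul : A →ₗ[F] rightMulAlgebra F A :=
  (LinearMap.mul F A).flip.codRestrict (Subalgebra.toSubmodule (rightMulAlgebra F A))
    fun a => Algebra.subset_adjoin ⟨a, rfl⟩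

variable {F A}

local notation "ρ" => rightMul F A

@[simp]
theorem coe_rightMul_apply (a x : A) : (ρ a : Module.End F A) x = x * a := rfl

instance [hA : Fact (IsNovikov A)] : IsMulCommutative (rightMulAlgebra F A) :=
  Algebra.isMulCommutative_adjoin F <| by
    rintro _ ⟨a, rfl⟩ _ ⟨b, rfl⟩
    exact LinearMap.ext fun x => hA.out.right_comm x b a

theorem IsNovikov.lie_mulLeft_rightMul (hA : IsNovikov A) (a b : A) :
    ⁅LinearMap.mulLeft F a, (ρ b : Module.End F A)⁆ =
      (ρ (a * b) - ρ a * ρ b : rightMulAlgebra F A) := by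
  ext x
  have h := hA.associator_symm a x b
  simp only [associator_apply] at h
  simp only [Ring.lie_def, LinearMap.sub_apply, Module.End.mul_apply, LinearMap.mulLeft_apply,
    AddSubgroupClass.coe_sub, MulMemClass.coe_mul, coe_rightMul_apply, hA.right_comm x b a]
  linear_combination (norm := abel) -h

theorem IsNovikov.lie_mulLeft_mem (hA : IsNovikov A) (a : A) {t : Module.End F A}
    (ht : t ∈ rightMulAlgebra F A) : ⁅LinearMap.mulLeft F a, t⁆ ∈ rightMulAlgebra F A := by
  induction ht using Algebra.adjoin_induction with
  | mem _ hb =>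
    obtain ⟨b, rfl⟩ := hb
    exact hA.lie_mulLeft_rightMul (F := F) a b ▸ SetLike.coe_mem _
  | algebraMap r =>
    rw [Ring.lie_def, (Algebra.commutes r _).symm, sub_self]
    exact zero_mem _
  | add s t _ _ hs ht =>
    have h : ⁅LinearMap.mulLeft F a, s + t⁆ =
        ⁅LinearMap.mulLeft F a, s⁆ + ⁅LinearMap.mulLeft F a, t⁆ := by
      simp only [Ring.lie_def]; noncomm_ring
    exact h ▸ add_mem hs ht
  | mul s t hs' ht' hs ht =>
    have h : ⁅LinearMap.mulLeft F a, s * t⁆ =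
        ⁅LinearMap.mulLeft F a, s⁆ * t + s * ⁅LinearMap.mulLeft F a, t⁆ := by
      simp only [Ring.lie_def]; noncomm_ring
    exact h ▸ add_mem (mul_mem hs ht') (mul_mem hs' ht)

theorem exists_add_eq_mul_of_isUnit {x : A} (h : IsUnit (1 - ρ x)) : ∃ y, x + y = y * x := by
  obtain ⟨s, hs⟩ := h.exists_right_inv
  have hx : (s : Module.End F A) x - (s : Module.End F A) x * x = x := by
    simpa using congrArg (fun t : rightMulAlgebra F A => (t : Module.End F A) x) hs
  refine ⟨-(s : Module.End F A) x, ?_⟩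
  rw [neg_mul]
  linear_combination (norm := abel) -hx

variable [hA : Fact (IsNovikov A)]

variable (F) in
/-- Commutation with the left multiplication by `a`, as a derivation of the right multiplication
algebra. -/
def leftMulDerivation (a : A) : Derivation F (rightMulAlgebra F A) (rightMulAlgebra F A) :=
  .mk'
    { toFun := fun t => ⟨⁅LinearMap.mulLeft F a, (t : Module.End F A)⁆,
        hA.out.lie_mulLeft_mem a t.2⟩
      map_add' := fun s t => Subtype.ext <| by
        simp only [Ring.lie_def, Subalgebra.coe_add]
        noncomm_ring
      map_smul' := fun r t => Subtype.ext <| by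
        simp [Ring.lie_def, smul_sub] }
    fun s t => Subtype.ext <| by
      rw [smul_eq_mul, smul_eq_mul, mul_comm t]
      simp only [Ring.lie_def, LinearMap.coe_mk, AddHom.coe_mk, Subalgebra.coe_add,
        Subalgebra.coe_mul]
      noncomm_ring

local notation "δ" => leftMulDerivation F

theorem leftMulDerivation_rightMul (a b : A) : δ a (ρ b) = ρ (a * b) - ρ a * ρ b :=
  Subtype.ext (hA.out.lie_mulLeft_rightMul a b)

theorem leftMulDerivation_mul (a b : A) : δ (a * b) = ρ b • δ a := by
  have hL : LinearMap.mulLeft F (a * b) = ρ b * LinearMap.mulLeft F a :=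
    LinearMap.ext fun x => hA.out.right_comm a b x
  refine Derivation.ext fun t => Subtype.ext ?_
  change ⁅LinearMap.mulLeft F (a * b), (t : Module.End F A)⁆ =
    ρ b * ⁅LinearMap.mulLeft F a, (t : Module.End F A)⁆
  have hcomm : (t : Module.End F A) * ρ b = ρ b * t := congrArg Subtype.val (mul_comm t (ρ b))
  rw [hL, Ring.lie_def, Ring.lie_def, ← mul_assoc, hcomm]
  noncomm_ring

theorem rightMul_lie (a b : A) : ρ ⁅a, b⁆ = δ a (ρ b) - δ b (ρ a) := by
  simp only [leftMulDerivation_rightMul, Ring.lie_def, map_sub, mul_comm (ρ b)]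
  abel

theorem leftMulDerivation_leftMulDerivation_rightMul (k u a : A) :
    δ k (δ u (ρ a)) = ρ ⁅k, u * a⁆ - ρ a * ρ ⁅k, u⁆ - ρ u * δ k (ρ a) := by
  rw [leftMulDerivation_rightMul u a, map_sub, Derivation.leibniz, rightMul_lie, rightMul_lie,
    leftMulDerivation_mul u a]
  simp only [Derivation.smul_apply, smul_eq_mul]
  ring

theorem two_mul_leftMulDerivation_rightMul_sq (k a : A) :
    2 * δ k (ρ a) ^ 2 = ρ ⁅k, k * a * a⁆ - 2 * ρ a * ρ ⁅k, k * a⁆ := by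
  have hk := leftMulDerivation_leftMulDerivation_rightMul (F := F) k k a
  have hka := leftMulDerivation_leftMulDerivation_rightMul (F := F) k (k * a) a
  have hρ := leftMulDerivation_rightMul (F := F) k a
  simp only [leftMulDerivation_mul, Derivation.smul_apply, smul_eq_mul, Derivation.leibniz] at hka
  rw [Ring.lie_def k k, sub_self, map_zero] at hk
  linear_combination hka - ρ a * hk + δ k (ρ a) * hρ

theorem isNilpotent_leftMulDerivation_rightMul (h2 : (2 : F) ≠ 0) {n : ℕ}
    (hnil : ∀ v ∈ lieSolvablePower F A (n + 1), IsNilpotent (ρ v)) {k : A}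
    (hk : k ∈ lieSolvablePower F A n) (a : A) : IsNilpotent (δ k (ρ a)) := by
  have hka := hA.out.lieSolvablePower_mul_mem h2 hk a
  have hkaa := hA.out.lieSolvablePower_mul_mem h2 hka a
  have hsq : IsNilpotent ((2 : F) • δ k (ρ a) ^ 2) := by
    rw [ofNat_smul_eq_nsmul, nsmul_eq_mul, Nat.cast_ofNat, two_mul_leftMulDerivation_rightMul_sq]
    exact (Commute.all _ _).isNilpotent_sub (hnil _ (lie_mem_lieSolvablePower_succ hk hkaa))
      ((Commute.all _ _).isNilpotent_mul_left (hnil _ (lie_mem_lieSolvablePower_succ hk hka)))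
  exact IsNilpotent.of_pow (inv_smul_smul₀ h2 (δ k (ρ a) ^ 2) ▸ hsq.smul (2 : F)⁻¹)

theorem isNilpotent_rightMul_of_succ (h2 : (2 : F) ≠ 0) {n : ℕ}
    (hnil : ∀ v ∈ lieSolvablePower F A (n + 2), IsNilpotent (ρ v)) {k : A}
    (hk : k ∈ lieSolvablePower F A (n + 1)) : IsNilpotent (ρ k) := by
  have hmul (b c : A) : ρ k * δ b (ρ c) ∈ nilradical (rightMulAlgebra F A) := by
    have h := isNilpotent_leftMulDerivation_rightMul h2 hnil
      (hA.out.mul_lieSolvablePower_mem h2 hk b) c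
    rwa [leftMulDerivation_mul] at h
  have hle : lieSolvablePower F A 1 ≤ ((nilradical (rightMulAlgebra F A)).restrictScalars F).comap
      (LinearMap.mulLeft F (ρ k) ∘ₗ ρ) := lieSolvablePower_succ_le.2 fun b _ c _ => by
    simpa [rightMul_lie, mul_sub] using sub_mem (hmul b c) (hmul c b)
  have hsq : IsNilpotent (ρ k * ρ k) := hle (lieSolvablePower_antitone (by simp) hk)
  exact IsNilpotent.of_pow (pow_two (ρ k) ▸ hsq)

theorem isNilpotent_rightMul_of_mem (h2 : (2 : F) ≠ 0) (hLie : IsLieSolvable F A) {v : A}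
    (hv : v ∈ lieSolvablePower F A 1) : IsNilpotent (ρ v) := by
  obtain ⟨n, hn⟩ := hLie
  have hbot : ∀ v ∈ lieSolvablePower F A (n + 1), IsNilpotent (ρ v) := fun v hv => by
    have hv0 : v ∈ lieSolvablePower F A n := lieSolvablePower_antitone n.le_succ hv
    rw [hn, Submodule.mem_bot] at hv0
    rw [hv0, map_zero]
    exact .zero
  clear hn
  induction n with
  | zero => exact hbot v hv
  | succ n ih => exact ih fun w hw => isNilpotent_rightMul_of_succ h2 hbot hw

theorem isUnit_one_sub_rightMul (h2 : (2 : F) ≠ 0) (hLie : IsLieSolvable F A) {x y : A}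
    (h : IsUnit (1 - ρ (x + y - y * x))) : IsUnit (1 - ρ x) := by
  have hnil : IsNilpotent (δ y (ρ x)) := isNilpotent_leftMulDerivation_rightMul (n := 0) h2
    (fun _ => isNilpotent_rightMul_of_mem h2 hLie) trivial x
  have hmul : (1 - ρ y) * (1 - ρ x) = -δ y (ρ x) + (1 - ρ (x + y - y * x)) := by
    rw [leftMulDerivation_rightMul, map_sub, map_add]
    ring
  refine isUnit_of_mul_isUnit_right (x := 1 - ρ y) ?_
  rw [hmul]
  exact hnil.neg.isUnit_add_right_of_commute h (Commute.all _ _)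

end RightMultiplication

theorem IsLeftQuasiregular.of_ideal_of_quotient {F A : Type*} [Field F] [NonUnitalNonAssocRing A]
    [Module F A] [IsScalarTower F A A] [SMulCommClass F A A] (h2 : (2 : F) ≠ 0)
    (hA : IsNovikov A) (hLie : IsLieSolvable F A) {I : AlgIdeal F A} (hI : IsLeftQuasiregular I)
    (hQ : IsLeftQuasiregular I.QuotAlg) : IsLeftQuasiregular A := by
  have : Fact (IsNovikov A) := ⟨hA⟩
  have hunitI : ∀ z ∈ I, IsUnit (1 - rightMul F A z) := by
    intro z hz
    obtain ⟨w, hw⟩ := hI ⟨z, hz⟩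
    have hzw : z + w - w * z = 0 := sub_eq_zero.2 (congrArg Subtype.val hw)
    refine isUnit_one_sub_rightMul h2 hLie (y := (w : A)) ?_
    simp only [hzw, map_zero, sub_zero, isUnit_one]
  intro x
  obtain ⟨y', hy⟩ := hQ (I.proj x)
  obtain ⟨y, rfl⟩ := I.proj_surjective y'
  rw [← map_add, ← I.proj_mul, I.proj_eq_proj] at hy
  exact exists_add_eq_mul_of_isUnit (isUnit_one_sub_rightMul h2 hLie (hunitI _ hy))

theorem IsLeftQuasiregular.of_surjective {F A B : Type*} [NonUnitalNonAssocRing A]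
    [NonUnitalNonAssocRing B] [FunLike F A B] [NonUnitalRingHomClass F A B]
    (hA : IsLeftQuasiregular A) {f : F} (hf : Function.Surjective f) : IsLeftQuasiregular B :=
  hf.forall.2 fun x => (hA x).elim fun y hy => ⟨f y, by rw [← map_add, hy, map_mul]⟩

namespace AlgIdeal

variable {F A : Type*} [Field F] [NonUnitalNonAssocRing A] [Module F A]

/-- The zero ideal is the least ideal; minimal ideals are the atoms of the order on ideals. -/
instance : OrderBot (AlgIdeal F A) where
  bot := { (⊥ : Submodule F A) with
    mul_mem_left' := by rintro a _ rfl; exact mul_zero a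
    mul_mem_right' := by rintro _ a rfl; exact zero_mul a }
  bot_le I := by rintro _ rfl; exact zero_mem I

theorem mem_bot {x : A} : x ∈ (⊥ : AlgIdeal F A) ↔ x = 0 := Iff.rfl

theorem toSubmodule_eq_bot {I : AlgIdeal F A} : I.toSubmodule = ⊥ ↔ I = ⊥ :=
  I.toSubmodule.eq_bot_iff.trans (eq_bot_iff (a := I)).symm

section IsMulCommutative

variable (hA : IsNovikov A) (J : AlgIdeal F A) [IsMulCommutative J]

include hA in
variable {J} in
theorem associator_eq_zero_of_mem_of_mem {x y : A} (hx : x ∈ J) (hy : y ∈ J) (c : A) :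
    associator x y c = 0 := by
  rw [associator_apply, setLike_mul_comm hx (J.mul_mem_right' y c hy), setLike_mul_comm hx hy,
    hA.right_comm, sub_self]

/-- The annihilator of the commutative ideal `J` within `J`, which is again an ideal of `A`. -/
def selfAnnihilator [IsScalarTower F A A] : AlgIdeal F A where
  carrier := {x | x ∈ J ∧ ∀ y ∈ J, x * y = 0}
  add_mem' ha hb := ⟨add_mem ha.1 hb.1, fun y hy => by rw [add_mul, ha.2 y hy, hb.2 y hy, add_zero]⟩
  zero_mem' := ⟨zero_mem J, fun y _ => zero_mul y⟩
  smul_mem' r _ ha := ⟨SMulMemClass.smul_mem r ha.1, fun y hy => by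
    rw [smul_mul_assoc, ha.2 y hy, smul_zero]⟩
  mul_mem_left' a x hx := ⟨J.mul_mem_left' a x hx.1, fun y hy => by
    have hay := J.mul_mem_left' a y hy
    rw [hA.right_comm, setLike_mul_comm hay hx.1, hx.2 _ hay]⟩
  mul_mem_right' x a hx := ⟨J.mul_mem_right' x a hx.1, fun y hy => by
    rw [hA.right_comm, hx.2 y hy, zero_mul]⟩

variable {J} {hA} [IsScalarTower F A A]

theorem eq_zero_of_selfAnnihilator_eq_bot (hJ : J.selfAnnihilator hA = ⊥) {x : A} (hx : x ∈ J)
    (hxJ : ∀ y ∈ J, x * y = 0) : x = 0 := by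
  have hmem : x ∈ J.selfAnnihilator hA := ⟨hx, hxJ⟩
  rwa [hJ, mem_bot] at hmem

theorem associator_eq_zero_of_mem (hJ : J.selfAnnihilator hA = ⊥) {x : A} (hx : x ∈ J) (b c : A) :
    associator x b c = 0 := by
  have hmem : associator x b c ∈ J :=
    sub_mem (J.mul_mem_right' _ c (J.mul_mem_right' x b hx)) (J.mul_mem_right' x _ hx)
  refine eq_zero_of_selfAnnihilator_eq_bot hJ hmem fun y hy => ?_
  rw [hA.associator_symm, ← hA.associator_mul_left]
  exact associator_eq_zero_of_mem_of_mem hA (J.mul_mem_left' b y hy) hx c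

theorem mul_comm_of_mem (hJ : J.selfAnnihilator hA = ⊥) {x : A} (hx : x ∈ J) (b : A) :
    b * x = x * b := by
  have hbx := J.mul_mem_left' b x hx
  refine sub_eq_zero.1 (eq_zero_of_selfAnnihilator_eq_bot hJ
    (sub_mem hbx (J.mul_mem_right' x b hx)) fun y hy => ?_)
  rw [sub_mul, sub_eq_zero]
  calc (b * x) * y = y * (b * x) := setLike_mul_comm hbx hy
    _ = (y * b) * x := (sub_eq_zero.1 (associator_eq_zero_of_mem hJ hy b x)).symm
    _ = (y * x) * b := hA.right_comm y b x
    _ = (x * b) * y := by rw [setLike_mul_comm hy hx, hA.right_comm]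

variable [SMulCommClass F A A]

/-- The set `xJ` of multiples of an element `x` of `J`, an ideal of `A` when `J` has zero
annihilator in itself. -/
def multiples (hJ : J.selfAnnihilator hA = ⊥) {x : A} (hx : x ∈ J) : AlgIdeal F A where
  toSubmodule := J.toSubmodule.map (LinearMap.mulLeft F x)
  mul_mem_left' := by
    rintro a _ ⟨y, hy, rfl⟩
    refine ⟨y * a, J.mul_mem_right' y a hy, ?_⟩
    have hxy := J.mul_mem_left' x y hy
    rw [LinearMap.mulLeft_apply, LinearMap.mulLeft_apply, mul_comm_of_mem hJ hxy]
    exact (sub_eq_zero.1 (associator_eq_zero_of_mem hJ hx y a)).symm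
  mul_mem_right' := by
    rintro _ a ⟨y, hy, rfl⟩
    exact ⟨y * a, J.mul_mem_right' y a hy,
      (sub_eq_zero.1 (associator_eq_zero_of_mem hJ hx y a)).symm⟩

theorem exists_mul_eq_self_of_isAtom (hJ : J.selfAnnihilator hA = ⊥) (hmin : IsAtom J) {x : A}
    (hx : x ∈ J) (hx0 : x ≠ 0) : ∃ e ∈ J, x * e = x := by
  have hle : multiples hJ hx ≤ J := by
    rintro _ ⟨y, hy, rfl⟩
    exact J.mul_mem_left' x y hy
  have hne : multiples hJ hx ≠ ⊥ := by
    refine fun h => hx0 (eq_zero_of_selfAnnihilator_eq_bot hJ hx fun y hy => ?_)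
    have hmem : x * y ∈ multiples hJ hx := ⟨y, hy, rfl⟩
    rwa [h, mem_bot] at hmem
  have hmem : x ∈ multiples hJ hx := by rwa [(hmin.le_iff.1 hle).resolve_left hne]
  exact hmem

end IsMulCommutative

end AlgIdeal

theorem IsLeftQuasiregular.mul_eq_zero_of_isAtom {F A : Type*} [Field F] [NonUnitalNonAssocRing A]
    [Module F A] [IsScalarTower F A A] [SMulCommClass F A A] (hqr : IsLeftQuasiregular A)
    (hA : IsNovikov A) {J : AlgIdeal F A} [IsMulCommutative J] (hmin : IsAtom J) {x y : A}
    (hx : x ∈ J) (hy : y ∈ J) : x * y = 0 := by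
  by_contra hxy
  have hJ : J.selfAnnihilator hA = ⊥ := by
    have hle : J.selfAnnihilator hA ≤ J := fun _ hz => And.left hz
    refine (hmin.le_iff.1 hle).resolve_right fun h => hxy ?_
    have hmem : x ∈ J.selfAnnihilator hA := by rwa [h]
    exact And.right hmem y hy
  have hx0 : x ≠ 0 := left_ne_zero_of_mul hxy
  obtain ⟨e, -, hxe⟩ := AlgIdeal.exists_mul_eq_self_of_isAtom hJ hmin hx hx0
  obtain ⟨z, hz⟩ := hqr e
  have hfix : x + x * z = x * z := calc
    x + x * z = x * (e + z) := by rw [mul_add, hxe]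
    _ = x * (z * e) := by rw [hz]
    _ = (x * z) * e := (sub_eq_zero.1 (AlgIdeal.associator_eq_zero_of_mem hJ hx z e)).symm
    _ = x * z := by rw [hA.right_comm, hxe]
  exact hx0 (add_eq_right.1 hfix)

section Heart

variable {F A : Type*} [Field F] [NonUnitalNonAssocRing A] [Module F A]

theorem heart_le {I : AlgIdeal F A} (hI : I.toSubmodule ≠ ⊥) : heart F A ≤ I.toSubmodule :=
  sInf_le ⟨I, rfl, hI⟩

variable (F A) in
/-- The heart as an ideal. -/
def heartIdeal : AlgIdeal F A where
  toSubmodule := heart F A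
  mul_mem_left' a x hx := Submodule.mem_sInf.2 <| by
    rintro _ ⟨I, rfl, hI⟩
    exact I.mul_mem_left' a x (heart_le hI hx)
  mul_mem_right' x a hx := Submodule.mem_sInf.2 <| by
    rintro _ ⟨I, rfl, hI⟩
    exact I.mul_mem_right' x a (heart_le hI hx)

theorem IsSubdirectlyIrreducible.isAtom_heartIdeal (h : IsSubdirectlyIrreducible F A) :
    IsAtom (heartIdeal F A) :=
  ⟨fun hbot => h (AlgIdeal.toSubmodule_eq_bot.2 hbot), fun _ hlt => by_contra fun hne =>
    hlt.not_ge (heart_le (mt AlgIdeal.toSubmodule_eq_bot.1 hne))⟩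

theorem HasIdempotentHeart.exists_mul_ne_zero (hidem : HasIdempotentHeart F A)
    (h : IsSubdirectlyIrreducible F A) :
    ∃ x ∈ heart F A, ∃ y ∈ heart F A, x * y ≠ 0 := by
  by_contra! hzero
  refine h (le_bot_iff.1 ?_)
  rw [← hidem, Submodule.span_le]
  rintro _ ⟨x, hx, y, hy, rfl⟩
  exact hzero x hx y hy

theorem IsLeftQuasiregular.not_isNovikovSIWithIdempotentHeart [IsScalarTower F A A]
    [SMulCommClass F A A] (hqr : IsLeftQuasiregular A) (h2 : (2 : F) ≠ 0)
    (hLie : IsLieSolvable F A) : ¬ IsNovikovSIWithIdempotentHeart F A := by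
  rintro ⟨hA, hsi, hidem⟩
  obtain ⟨x, hx, y, hy, hxy⟩ := hidem.exists_mul_ne_zero hsi
  have : Nontrivial A := nontrivial_of_ne _ _ hxy
  obtain ⟨K, hK, _⟩ := hLie.exists_isMulCommutative_ideal hA h2
  have : IsMulCommutative (heartIdeal F A) := .of_setLike_mul_comm fun a ha b hb =>
    setLike_mul_comm (s := K) (heart_le hK ha) (heart_le hK hb)
  exact hxy (hqr.mul_eq_zero_of_isAtom hA hsi.isAtom_heartIdeal hx hy)

end Heart

section Radical

variable {F : Type*} {A : Type u} [Field F] [NonUnitalNonAssocRing A] [Module F A]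

theorem IsLeftQuasiregular.isAndrunakievich (hqr : IsLeftQuasiregular A) (h2 : (2 : F) ≠ 0)
    (hA : IsNovikov A) (hLie : IsLieSolvable F A) : IsAndrunakievich F A :=
  ⟨hA, fun _ _ _ _ _ _ hf =>
    (hqr.of_surjective hf).not_isNovikovSIWithIdempotentHeart h2 (hLie.of_surjective hf)⟩

theorem IsAndrunakievich.of_surjective {B : Type u} [NonUnitalNonAssocRing B] [Module F B]
    (hA : IsAndrunakievich F A) {f : A →ₙₐ[F] B} (hf : Function.Surjective f) :
    IsAndrunakievich F B :=
  ⟨hA.1.of_surjective hf, fun C _ _ _ _ g hg => hA.2 C (g.comp f) (hg.comp hf)⟩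

theorem IsAndrunakievich.isAndrunakievichRadical_top (hA : IsAndrunakievich F A) :
    IsAndrunakievichRadical (⊤ : AlgIdeal F A) :=
  let f : A →ₙₐ[F] (⊤ : AlgIdeal F A) :=
    { toFun := fun a => ⟨a, trivial⟩
      map_smul' := fun _ _ => rfl
      map_zero' := rfl
      map_add' := fun _ _ => rfl
      map_mul' := fun _ _ => rfl }
  have hf : Function.Surjective f := fun x => ⟨x, rfl⟩
  ⟨hA.of_surjective hf, fun _ _ _ _ => trivial⟩

end Radical

theorem lemma5 {F : Type*} [Field F] (hF : ringChar F ≠ 2)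
    {A : Type*} [NonUnitalNonAssocRing A] [Module F A] [IsScalarTower F A A] [SMulCommClass F A A]
    (hA : IsNovikov A) (hLie : IsLieSolvable F A)
    (I : AlgIdeal F A) (hI : IsLeftQuasiregular I) (hQ : IsLeftQuasiregular I.QuotAlg) :
    IsLeftQuasiregular A ∧ IsAndrunakievichRadical (⊤ : AlgIdeal F A) := by
  have h2 : (2 : F) ≠ 0 := Ring.two_ne_zero hF
  have hqr : IsLeftQuasiregular A := .of_ideal_of_quotient h2 hA hLie hI hQ
  exact ⟨hqr, (hqr.isAndrunakievich h2 hA hLie).isAndrunakievichRadical_top⟩
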